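/- Let $f\in L^\infty(0,1)$ be such that the left and right approximate limits $$f^-(x):=\lim_{y\to x^-}\frac1{x-y}\int_y^x f(t)\,dt,\qquad f^+(x):=\lim_{y\to x^+}\frac1{y-x}\int_x^y f(t)\,dt$$ exist in $\mathbb R$ at every $x\in(0,1)$, and let $\alpha>0$. For $w\in L^1_{\mathrm{loc}}(0,1)$ let the jump set $J_w$ be the set of all $x\in(0,1)$ at which the approximate limits $w^-(x)$ and $w^+(x)$, defined in the same way, both exist and are different. Let $u_\alpha\in BV(0,1)$ be the solution of the ROF problem, i.e. the minimizer over $BV(0,1)$ of $$u\mapsto \tfrac12\|u-f\|_{L^2(0,1)}^2+\alpha\,TV(u,(0,1)),\qquad TV(u,(0,1)):=\sup\Big\{\int_0^1 u\,\psi'\,dx:\ \psi\in C^1_c(0,1),\ |\psi|\le 1\Big\},$$ where $BV(0,1)$ is the set of $u\in L^1(0,1)$ with $TV(u,(0,1))<\infty$. Let $F(t):=\int_0^t f(x)\,dx$ for $t\in[0,1]$, and let $U_\alpha$ be the solution of the taut string problem, i.e. the minimizer of the graph length $\int_0^1\sqrt{1+U'(x)^2}\,dx$ among all absolutely continuous $U$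 with $|U-F|\le\alpha$ on $(0,1)$, $U(0)=F(0)=0$ and $U(1)=F(1)$. Define the contact sets $$C_\alpha^{+}:=\{x\in(0,1):U_\alpha(x)=F(x)+\alpha\},\qquad C_\alpha^{-}:=\{x\in(0,1):U_\alpha(x)=F(x)-\alpha\}.$$ Then $$J_{u_\alpha}\subseteq J_f\cap(C_\alpha^+\cup C_\alpha^-).$$ More precisely, $$J_{u_\alpha}\cap\operatorname{int}(C_\alpha^+\cup C_\alpha^-)=J_f\cap\operatorname{int}(C_\alpha^+\cup C_\alpha^-)\qquad\text{and}\qquad J_{u_\alpha}\cap\partial(C_\alpha^+\cup C_\alpha^-)\subseteq J_f.$$ -/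

import Mathlib

open MeasureTheory Set Filter Topology
open scoped ENNReal

namespace TautString

/-- Lebesgue measure on the open unit interval `(0,1)`. -/
noncomputable def lebUnit : Measure ℝ := volume.restrict (Ioo (0 : ℝ) 1)

/-- Test fields for the total variation: `ψ ∈ C¹_c(0,1)` with `|ψ| ≤ 1`. -/
def IsTestField (ψ : ℝ → ℝ) : Prop :=
  ContDiff ℝ 1 ψ ∧ HasCompactSupport ψ ∧ tsupport ψ ⊆ Ioo (0 : ℝ) 1 ∧ ∀ x, |ψ x| ≤ 1

/-- `TV(u,(0,1)) = sup {∫₀¹ u ψ' : ψ ∈ C¹_c(0,1), |ψ| ≤ 1}`, with values in `[0,∞]`.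
Truncating negative integrals at `0` is harmless, since `ψ = 0` is admissible. -/
noncomputable def totalVar (u : ℝ → ℝ) : ℝ≥0∞ :=
  ⨆ (ψ : ℝ → ℝ) (_ : IsTestField ψ), ENNReal.ofReal (∫ x, u x * deriv ψ x ∂lebUnit)

/-- `u ∈ BV(0,1)`. -/
def MemBV (u : ℝ → ℝ) : Prop :=
  Integrable u lebUnit ∧ totalVar u < ∞

/-- The ROF functional `½ ‖u - f‖²_{L²(0,1)} + α TV(u,(0,1))`, with values in `[0,∞]`. -/
noncomputable def rofEnergy (f : ℝ → ℝ) (α : ℝ) (u : ℝ → ℝ) : ℝ≥0∞ :=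
  2⁻¹ * eLpNorm (fun x => u x - f x) 2 lebUnit ^ 2 + ENNReal.ofReal α * totalVar u

/-- `u` minimizes the ROF functional over `BV(0,1)`. -/
def IsROFSolution (f : ℝ → ℝ) (α : ℝ) (u : ℝ → ℝ) : Prop :=
  MemBV u ∧ ∀ v, MemBV v → rofEnergy f α u ≤ rofEnergy f α v

/-- The primitive `F(t) = ∫₀ᵗ f`. -/
noncomputable def primitive (f : ℝ → ℝ) (t : ℝ) : ℝ := ∫ x in (0 : ℝ)..t, f x

/-- The admissible class of the taut string problem. An absolutely continuous function on `(0,1)`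
is identified with its continuous extension to `[0,1]`, which gives meaning to the boundary
values. -/
def IsAdmissible (f : ℝ → ℝ) (α : ℝ) (U : ℝ → ℝ) : Prop :=
  AbsolutelyContinuousOnInterval U 0 1 ∧
    (∀ x ∈ Ioo (0 : ℝ) 1, |U x - primitive f x| ≤ α) ∧
    U 0 = 0 ∧ U 1 = primitive f 1

/-- The length `∫₀¹ √(1 + (U')²)` of the graph of `U`. For absolutely continuous `U` the derivative
exists a.e. and the integrand is integrable. -/
noncomputable def graphLength (U : ℝ → ℝ) : ℝ :=
  ∫ x, Real.sqrt (1 + deriv U x ^ 2) ∂lebUnit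

/-- `U` solves the taut string problem. -/
def IsTautStringSolution (f : ℝ → ℝ) (α : ℝ) (U : ℝ → ℝ) : Prop :=
  IsAdmissible f α U ∧ ∀ V, IsAdmissible f α V → graphLength U ≤ graphLength V

/-- The upper contact set `{x ∈ (0,1) : U(x) = F(x) + α}`. -/
def upperContact (f : ℝ → ℝ) (α : ℝ) (U : ℝ → ℝ) : Set ℝ :=
  {x | x ∈ Ioo (0 : ℝ) 1 ∧ U x = primitive f x + α}

/-- The lower contact set `{x ∈ (0,1) : U(x) = F(x) - α}`. -/
def lowerContact (f : ℝ → ℝ) (α : ℝ) (U : ℝ → ℝ) : Set ℝ :=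
  {x | x ∈ Ioo (0 : ℝ) 1 ∧ U x = primitive f x - α}

/-- The left approximate limit of `w` at `x` exists and equals `l`. -/
def HasLeftApproxLim (w : ℝ → ℝ) (x l : ℝ) : Prop :=
  Tendsto (fun y => ⨍ t in y..x, w t) (𝓝[<] x) (𝓝 l)

/-- The right approximate limit of `w` at `x` exists and equals `r`. -/
def HasRightApproxLim (w : ℝ → ℝ) (x r : ℝ) : Prop :=
  Tendsto (fun y => ⨍ t in x..y, w t) (𝓝[>] x) (𝓝 r)

/-- The jump set of `w`: the points of `(0,1)` at which both one-sided approximate limits exist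
and are different. -/
def jumpSet (w : ℝ → ℝ) : Set ℝ :=
  {x | x ∈ Ioo (0 : ℝ) 1 ∧
    ∃ l r : ℝ, HasLeftApproxLim w x l ∧ HasRightApproxLim w x r ∧ l ≠ r}

end TautString

/-! The string `U` turns out to be the primitive of the ROF solution `u`, so jumps of `u` are kinks
of `U`. Both functions are taut: they stay in the tube around the primitive `F` of `f`, and they
coincide with each of their chords that fits in the tube. A taut function is concave near points off
the upper contact set and convex near points off the lower one. Hence the difference of two taut
functions is convex near a positive maximum, which gives uniqueness by a maximum principle
(`IsTaut.le`).

Tautness of both minimizers comes from the equality case of Jensen's inequality, on replacing the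
derivative by its mean on an interval. For the string the replacement is a competitor. For ROF, the
Euler-Lagrange inequality is combined with the duality between total variation and fields bounded by
`α` (`integral_mul_le_totalVar`); this shows that `u` has least `L²` norm among derivatives of
functions in the tube with the same end values.

Off both contact sets `U` is locally convex and concave, so `u` cannot jump. At an upper contact
point `U` is locally convex and `U - F` is maximal, so a jump satisfies `f⁻ ≤ u⁻ < u⁺ ≤ f⁺`; lower
contact is symmetric. In the interior of the contact set `U - F` is locally constant, and the two
jump sets agree there. -/

namespace TautString

/-! ### Taut functions: local convexity, uniqueness, one-sided slopes -/

/-- A continuous function on `[0,1]` in the tube of radius `α` around `F`, with prescribed boundary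
values, that coincides with each of its chords lying in the tube. -/
structure IsTaut (F : ℝ → ℝ) (α : ℝ) (G : ℝ → ℝ) : Prop where
  continuousOn : ContinuousOn G (Icc 0 1)
  zero : G 0 = 0
  one : G 1 = F 1
  mem_tube : ∀ x ∈ Icc (0 : ℝ) 1, |G x - F x| ≤ α
  eq_chord : ∀ p q m : ℝ, 0 ≤ p → p < q → q ≤ 1 → G q = G p + m * (q - p) →
    (∀ x ∈ Icc p q, |G p + m * (x - p) - F x| ≤ α) → ∀ x ∈ Icc p q, G x = G p + m * (x - p)

/-- Reflection exchanges the upper and lower contact sets, so each one-sided argument is needed only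
once. -/
theorem IsTaut.neg {F G : ℝ → ℝ} {α : ℝ} (h : IsTaut F α G) :
    IsTaut (fun x => -F x) α (fun x => -G x) where
  continuousOn := h.continuousOn.neg
  zero := by simp [h.zero]
  one := by simp [h.one]
  mem_tube x hx := by
    have := h.mem_tube x hx
    rwa [← abs_neg, show -(-G x - -F x) = G x - F x by ring]
  eq_chord p q m hp hpq hq hm hx y hy := by
    have := h.eq_chord p q (-m) hp hpq hq (by linarith) (fun x hx' => by
      have := hx x hx'
      rwa [← abs_neg, show -(-G p + m * (x - p) - -F x) = G p + -m * (x - p) - F x by ring]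
        at this) y hy
    linarith

/-- A negative value of a continuous function lies between two zeros delimiting an interval on
which the function is nonpositive. -/
theorem exists_zeros_of_neg {D : ℝ → ℝ} {p z q : ℝ} (hD : ContinuousOn D (Icc p q))
    (hp : D p = 0) (hq : D q = 0) (hz : D z < 0) (hpz : p < z) (hzq : z < q) :
    ∃ a b, p ≤ a ∧ a < z ∧ z < b ∧ b ≤ q ∧ D a = 0 ∧ D b = 0 ∧ ∀ x ∈ Icc a b, D x ≤ 0 := by
  have h1 : IsCompact (Icc p z ∩ D ⁻¹' {0}) :=
    isCompact_Icc.of_isClosed_subset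
      ((hD.mono (Icc_subset_Icc_right hzq.le)).preimage_isClosed_of_isClosed isClosed_Icc
        isClosed_singleton) inter_subset_left
  have h2 : IsCompact (Icc z q ∩ D ⁻¹' {0}) :=
    isCompact_Icc.of_isClosed_subset
      ((hD.mono (Icc_subset_Icc_left hpz.le)).preimage_isClosed_of_isClosed isClosed_Icc
        isClosed_singleton) inter_subset_left
  -- The zeros nearest to `z` on either side; a positive value between them would force a nearer
  -- zero.
  obtain ⟨a, ⟨⟨ha1, ha2⟩, ha0⟩, ha⟩ := h1.exists_isGreatest ⟨p, ⟨le_rfl, hpz.le⟩, hp⟩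
  obtain ⟨b, ⟨⟨hb1, hb2⟩, hb0⟩, hb⟩ := h2.exists_isLeast ⟨q, ⟨hzq.le, le_rfl⟩, hq⟩
  simp only [mem_preimage, mem_singleton_iff] at ha0 hb0
  have haz : a < z := lt_of_le_of_ne ha2 (by rintro rfl; linarith)
  have hzb : z < b := lt_of_le_of_ne hb1 (by rintro rfl; linarith)
  refine ⟨a, b, ha1, haz, hzb, hb2, ha0, hb0, fun x hx => ?_⟩
  by_contra! hx0
  rcases le_total x z with hxz | hzx
  · obtain ⟨y, hy, hy0⟩ := intermediate_value_Icc' hxz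
      (hD.mono (Icc_subset_Icc (ha1.trans hx.1) hzq.le)) ⟨hz.le, hx0.le⟩
    have hya : y ≤ a := ha ⟨⟨ha1.trans (hx.1.trans hy.1), hy.2⟩, hy0⟩
    have : x = a := le_antisymm (hy.1.trans hya) hx.1
    subst this; linarith
  · obtain ⟨y, hy, hy0⟩ := intermediate_value_Icc hzx
      (hD.mono (Icc_subset_Icc hpz.le (hx.2.trans hb2))) ⟨hz.le, hx0.le⟩
    have hyb : b ≤ y := hb ⟨⟨hy.1, hy.2.trans (hx.2.trans hb2)⟩, hy0⟩
    have : x = b := le_antisymm hx.2 (hyb.trans hy.2)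
    subst this; linarith

/-- A taut function is concave near every point off the upper contact set. -/
theorem IsTaut.exists_concaveOn {F G : ℝ → ℝ} {α : ℝ} (h : IsTaut F α G)
    (hF : ContinuousOn F (Icc 0 1)) {x₀ : ℝ} (hx₀ : x₀ ∈ Ioo (0 : ℝ) 1) (hlt : G x₀ < F x₀ + α) :
    ∃ δ > 0, Ioo (x₀ - δ) (x₀ + δ) ⊆ Icc 0 1 ∧ ConcaveOn ℝ (Ioo (x₀ - δ) (x₀ + δ)) G := by
  have hn : Icc (0 : ℝ) 1 ∈ 𝓝 x₀ := Icc_mem_nhds hx₀.1 hx₀.2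
  -- Half of the gap `g` is allotted to the oscillation of `G` and half to that of `F`, so near `x₀`
  -- all values of `G`, and hence its chords, lie below `F + α`.
  set g := F x₀ + α - G x₀ with hg
  have hg0 : 0 < g := by linarith
  have e1 : ∀ᶠ y in 𝓝 x₀, G y < G x₀ + g / 2 :=
    (h.continuousOn.continuousAt hn).eventually_lt_const (by linarith)
  have e2 : ∀ᶠ y in 𝓝 x₀, F x₀ - g / 2 < F y :=
    (hF.continuousAt hn).eventually_const_lt (by linarith)
  obtain ⟨δ, hδ, hball⟩ := Metric.eventually_nhds_iff_ball.1 ((e1.and e2).and hn)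
  rw [Real.ball_eq_Ioo] at hball
  refine ⟨δ, hδ, fun y hy => (hball y hy).2, concaveOn_of_slope_anti_adjacent (convex_Ioo _ _) ?_⟩
  intro p z q hp hq hpz hzq
  by_contra! hcon
  set m := (G q - G p) / (q - p) with hm
  have hqp : 0 < q - p := by linarith
  have hmul : m * (q - p) = G q - G p := div_mul_cancel₀ _ hqp.ne'
  have hsub : Icc p q ⊆ Ioo (x₀ - δ) (x₀ + δ) :=
    fun y hy => ⟨hp.1.trans_le hy.1, hy.2.trans_lt hq.2⟩
  have hsub' : Icc p q ⊆ Icc 0 1 := fun y hy => (hball y (hsub hy)).2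
  have hDz : G z - (G p + m * (z - p)) < 0 := by
    rw [div_lt_div_iff₀ (by linarith) (by linarith)] at hcon
    have : (G z - (G p + m * (z - p))) * (q - p) < 0 := by
      have : (G z - (G p + m * (z - p))) * (q - p)
        = (G z - G p) * (q - p) - (m * (q - p)) * (z - p) := by ring
      rw [this, hmul]; nlinarith
    exact lt_of_not_ge fun hge => this.not_ge (mul_nonneg hge hqp.le)
  -- A failure of concavity puts `G` below its chord at `z`. Between the neighbouring zeros `a` and
  -- `b`, the chord lies above `G`, hence above `F - α`, and stays below `F + α`; tautness then
  -- forces equality at `z`.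
  obtain ⟨a, b, hpa, haz, hzb, hbq, ha0, hb0, hab⟩ :=
    exists_zeros_of_neg (D := fun x => G x - (G p + m * (x - p)))
      ((h.continuousOn.mono hsub').sub (by fun_prop)) (by simp) (by simp [hmul]) hDz hpz hzq
  have hch := h.eq_chord a b m (hsub' ⟨hpa, (haz.trans hzq).le⟩).1 (haz.trans hzb)
    (hsub' ⟨(hpz.trans hzb).le, hbq⟩).2 (by linarith) (fun x hx => ?_) z ⟨haz.le, hzb.le⟩
  · linarith
  · have hxpq : x ∈ Icc p q := ⟨hpa.trans hx.1, hx.2.trans hbq⟩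
    have hL : G a + m * (x - a) = G p + m * (x - p) := by linarith
    rw [hL, abs_le]
    have h3 := hab x hx
    have h4 := abs_le.1 (h.mem_tube x (hsub' hxpq))
    refine ⟨by linarith, ?_⟩
    have hFx := (hball x (hsub hxpq)).1.2
    have hGp := (hball p hp).1.1
    have hGq := (hball q hq).1.1
    have : G p + m * (x - p) ≤ max (G p) (G q) := by
      rcases le_total 0 m with hm0 | hm0
      · refine le_trans ?_ (le_max_right _ _)
        have := mul_le_mul_of_nonneg_left (sub_le_sub_right hxpq.2 p) hm0
        linarith
      · refine le_trans ?_ (le_max_left _ _)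
        have := mul_nonpos_of_nonpos_of_nonneg hm0 (sub_nonneg.2 hxpq.1)
        linarith
    rcases max_choice (G p) (G q) with hc | hc <;> rw [hc] at this <;> linarith

/-- A taut function is convex near every point off the lower contact set. -/
theorem IsTaut.exists_convexOn {F G : ℝ → ℝ} {α : ℝ} (h : IsTaut F α G)
    (hF : ContinuousOn F (Icc 0 1)) {x₀ : ℝ} (hx₀ : x₀ ∈ Ioo (0 : ℝ) 1) (hlt : F x₀ - α < G x₀) :
    ∃ δ > 0, Ioo (x₀ - δ) (x₀ + δ) ⊆ Icc 0 1 ∧ ConvexOn ℝ (Ioo (x₀ - δ) (x₀ + δ)) G := by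
  obtain ⟨δ, hδ, hs, hc⟩ := h.neg.exists_concaveOn hF.neg hx₀ (by linarith)
  exact ⟨δ, hδ, hs, by simpa [Pi.neg_def] using hc.neg⟩

/-- Maximum principle: where `H < G`, the graph of `G` is off the lower boundary and that of `H` off
the upper one, so `G - H` is locally convex. This is impossible at the leftmost point of a positive
maximum. -/
theorem IsTaut.le {F G H : ℝ → ℝ} {α : ℝ} (hG : IsTaut F α G) (hH : IsTaut F α H)
    (hF : ContinuousOn F (Icc 0 1)) {x : ℝ} (hx : x ∈ Icc (0 : ℝ) 1) : G x ≤ H x := by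
  by_contra! hlt
  set D : ℝ → ℝ := fun y => G y - H y with hD
  have hDc : ContinuousOn D (Icc 0 1) := hG.continuousOn.sub hH.continuousOn
  obtain ⟨z, hz, hzmax⟩ := isCompact_Icc.exists_isMaxOn ⟨x, hx⟩ hDc
  have hzmax : ∀ y ∈ Icc (0 : ℝ) 1, D y ≤ D z := hzmax
  have hpos : 0 < D z := lt_of_lt_of_le (by simp only [hD]; linarith) (hzmax x hx)
  have hK : IsCompact (Icc 0 1 ∩ D ⁻¹' {D z}) :=
    isCompact_Icc.of_isClosed_subset
      (hDc.preimage_isClosed_of_isClosed isClosed_Icc isClosed_singleton) inter_subset_left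
  obtain ⟨y, ⟨hy, hyz⟩, hleast⟩ := hK.exists_isLeast ⟨z, hz, rfl⟩
  have hyz : D y = D z := hyz
  have hy0 : y ≠ 0 := by
    rintro rfl
    simp only [hD, hG.zero, hH.zero] at hyz hpos
    linarith
  have hy1 : y ≠ 1 := by
    rintro rfl
    simp only [hD, hG.one, hH.one] at hyz hpos
    linarith
  have hyI : y ∈ Ioo (0 : ℝ) 1 := ⟨hy.1.lt_of_ne' hy0, hy.2.lt_of_ne hy1⟩
  have hDy : H y < G y := by simp only [hD] at hyz hpos; linarith
  obtain ⟨δ, hδ, hs, hc⟩ := hG.exists_convexOn hF hyI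
    (by linarith [(abs_le.1 (hH.mem_tube y hy)).1])
  obtain ⟨ε, hε, hs', hc'⟩ := hH.exists_concaveOn hF hyI
    (by linarith [(abs_le.1 (hG.mem_tube y hy)).2])
  set t := min δ ε / 2 with ht
  have hm : 0 < min δ ε := lt_min hδ hε
  have ht0 : 0 < t := by positivity
  have htδ : t < δ := by linarith [min_le_left δ ε]
  have htε : t < ε := by linarith [min_le_right δ ε]
  have h1 := hc.2 (show y - t ∈ Ioo (y - δ) (y + δ) from ⟨by linarith, by linarith⟩)
    (show y + t ∈ Ioo (y - δ) (y + δ) from ⟨by linarith, by linarith⟩)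
    (show (0 : ℝ) ≤ 1 / 2 by norm_num) (show (0 : ℝ) ≤ 1 / 2 by norm_num) (by norm_num)
  have h2 := hc'.2 (show y - t ∈ Ioo (y - ε) (y + ε) from ⟨by linarith, by linarith⟩)
    (show y + t ∈ Ioo (y - ε) (y + ε) from ⟨by linarith, by linarith⟩)
    (show (0 : ℝ) ≤ 1 / 2 by norm_num) (show (0 : ℝ) ≤ 1 / 2 by norm_num) (by norm_num)
  simp only [smul_eq_mul] at h1 h2
  rw [show 1 / 2 * (y - t) + 1 / 2 * (y + t) = y by ring] at h1 h2
  have ha : y - t ∈ Icc (0 : ℝ) 1 := hs ⟨by linarith, by linarith⟩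
  have hb := hzmax (y + t) (hs ⟨by linarith, by linarith⟩)
  -- Strict because `y` is the leftmost maximum point; this contradicts midpoint convexity at `y`.
  have ha' : D (y - t) < D z := (hzmax _ ha).lt_of_ne fun heq => by
    have := hleast ⟨ha, heq⟩
    linarith
  simp only [hD] at ha' hb hyz
  linarith

theorem IsTaut.eqOn {F G H : ℝ → ℝ} {α : ℝ} (hG : IsTaut F α G) (hH : IsTaut F α H)
    (hF : ContinuousOn F (Icc 0 1)) : EqOn G H (Icc 0 1) :=
  fun _ hx => le_antisymm (hG.le hH hF hx) (hH.le hG hF hx)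

/-- At a point off the upper contact set, the one-sided slopes of a taut function do not increase. -/
theorem IsTaut.right_slope_le_left {F G : ℝ → ℝ} {α : ℝ} (h : IsTaut F α G)
    (hF : ContinuousOn F (Icc 0 1)) {x l r : ℝ} (hx : x ∈ Ioo (0 : ℝ) 1) (hlt : G x < F x + α)
    (hl : Tendsto (fun y => (G x - G y) / (x - y)) (𝓝[<] x) (𝓝 l))
    (hr : Tendsto (fun y => (G y - G x) / (y - x)) (𝓝[>] x) (𝓝 r)) : r ≤ l := by
  obtain ⟨δ, hδ, -, hc⟩ := h.exists_concaveOn hF hx hlt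
  refine ge_of_tendsto hl ?_
  filter_upwards [Ioo_mem_nhdsLT (show x - δ < x by linarith)] with y hy
  refine le_of_tendsto hr ?_
  filter_upwards [Ioo_mem_nhdsGT (show x < x + δ by linarith)] with z hz
  exact hc.slope_anti_adjacent ⟨hy.1, by linarith [hy.2]⟩ ⟨by linarith [hz.1], hz.2⟩ hy.2 hz.1

/-- At a point off the lower contact set, the one-sided slopes of a taut function do not decrease. -/
theorem IsTaut.left_slope_le_right {F G : ℝ → ℝ} {α : ℝ} (h : IsTaut F α G)
    (hF : ContinuousOn F (Icc 0 1)) {x l r : ℝ} (hx : x ∈ Ioo (0 : ℝ) 1) (hlt : F x - α < G x)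
    (hl : Tendsto (fun y => (G x - G y) / (x - y)) (𝓝[<] x) (𝓝 l))
    (hr : Tendsto (fun y => (G y - G x) / (y - x)) (𝓝[>] x) (𝓝 r)) : l ≤ r := by
  have := h.neg.right_slope_le_left hF.neg hx (l := -l) (r := -r) (by linarith)
    (hl.neg.congr fun y => by ring) (hr.neg.congr fun y => by ring)
  linarith

/-! ### Primitives and averaging on a subinterval -/

theorem lebUnit_eq_restrict_Ioc : lebUnit = volume.restrict (Ioc (0 : ℝ) 1) :=
  restrict_Ioo_eq_restrict_Ioc

instance : IsProbabilityMeasure lebUnit :=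
  ⟨by simp [lebUnit]⟩

theorem integrable_lebUnit_iff {g : ℝ → ℝ} :
    Integrable g lebUnit ↔ IntervalIntegrable g volume 0 1 := by
  rw [intervalIntegrable_iff_integrableOn_Ioc_of_le zero_le_one, lebUnit_eq_restrict_Ioc,
    IntegrableOn]

theorem lebUnit_restrict_Ioc {p q : ℝ} (hp : 0 ≤ p) (hq : q ≤ 1) :
    lebUnit.restrict (Ioc p q) = volume.restrict (Ioc p q) := by
  rw [lebUnit_eq_restrict_Ioc, Measure.restrict_restrict measurableSet_Ioc,
    inter_eq_left.2 (Ioc_subset_Ioc hp hq)]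

theorem _root_.IntervalIntegrable.mono_unit {g : ℝ → ℝ} (hg : IntervalIntegrable g volume 0 1)
    {a b : ℝ} (ha : a ∈ Icc (0 : ℝ) 1) (hb : b ∈ Icc (0 : ℝ) 1) :
    IntervalIntegrable g volume a b :=
  hg.mono_set (by rw [uIcc_of_le zero_le_one]; exact ordConnected_Icc.uIcc_subset ha hb)

theorem primitive_sub {g : ℝ → ℝ} (hg : IntervalIntegrable g volume 0 1)
    {a b : ℝ} (ha : a ∈ Icc (0 : ℝ) 1) (hb : b ∈ Icc (0 : ℝ) 1) :
    primitive g b - primitive g a = ∫ x in a..b, g x :=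
  intervalIntegral.integral_interval_sub_left (hg.mono_unit (by simp) hb)
    (hg.mono_unit (by simp) ha)

theorem continuousOn_primitive {g : ℝ → ℝ} (hg : IntervalIntegrable g volume 0 1) :
    ContinuousOn (primitive g) (Icc 0 1) := by
  have := intervalIntegral.continuousOn_primitive_interval (μ := volume) (f := g) (a := 0) (b := 1)
    (by rw [uIcc_of_le zero_le_one]
        exact (intervalIntegrable_iff_integrableOn_Icc_of_le zero_le_one).1 hg)
  rwa [uIcc_of_le zero_le_one] at this

@[simp] theorem primitive_zero (g : ℝ → ℝ) : primitive g 0 = 0 := by simp [primitive]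

open Classical in
/-- The function `g` with its values on `(p,q]` replaced by the constant `m`. -/
noncomputable def constOn (g : ℝ → ℝ) (p q m : ℝ) : ℝ → ℝ :=
  (Ioc p q).piecewise (fun _ => m) g

theorem constOn_of_mem {g : ℝ → ℝ} {p q m x : ℝ} (hx : x ∈ Ioc p q) : constOn g p q m x = m := by
  simp [constOn, hx]

theorem constOn_of_notMem {g : ℝ → ℝ} {p q m x : ℝ} (hx : x ∉ Ioc p q) :
    constOn g p q m x = g x := by
  simp [constOn, hx]

theorem memLp_constOn {g : ℝ → ℝ} {r : ℝ≥0∞} (hg : MemLp g r lebUnit) (p q m : ℝ) :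
    MemLp (constOn g p q m) r lebUnit := by
  classical
  exact MemLp.piecewise measurableSet_Ioc (memLp_const m) (hg.restrict _)

theorem intervalIntegrable_constOn {g : ℝ → ℝ} (hg : IntervalIntegrable g volume 0 1)
    (p q m : ℝ) : IntervalIntegrable (constOn g p q m) volume 0 1 := by
  rw [← integrable_lebUnit_iff, ← memLp_one_iff_integrable] at hg ⊢
  exact memLp_constOn hg p q m

theorem primitive_constOn_of_le {g : ℝ → ℝ} {p q m x : ℝ} (hx0 : 0 ≤ x) (hx : x ≤ p) :
    primitive (constOn g p q m) x = primitive g x :=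
  intervalIntegral.integral_congr_uIoo fun y hy => by
    rw [uIoo_of_le hx0] at hy
    exact constOn_of_notMem fun h => by linarith [hy.2, h.1]

theorem primitive_constOn_of_mem {g : ℝ → ℝ} (hg : IntervalIntegrable g volume 0 1)
    {p q m x : ℝ} (hp : 0 ≤ p) (hq : q ≤ 1) (hx : x ∈ Icc p q) :
    primitive (constOn g p q m) x = primitive g p + m * (x - p) := by
  have h := primitive_sub (intervalIntegrable_constOn hg p q m) (a := p) (b := x)
    ⟨hp, hx.1.trans (hx.2.trans hq)⟩ ⟨hp.trans hx.1, hx.2.trans hq⟩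
  have h' : ∫ y in p..x, constOn g p q m y = ∫ _ in p..x, m :=
    intervalIntegral.integral_congr_uIoo fun y hy => by
      rw [uIoo_of_le hx.1] at hy
      exact constOn_of_mem ⟨hy.1, hy.2.le.trans hx.2⟩
  rw [h', intervalIntegral.integral_const, smul_eq_mul, primitive_constOn_of_le hp le_rfl] at h
  linarith

theorem primitive_constOn_of_ge {g : ℝ → ℝ} (hg : IntervalIntegrable g volume 0 1)
    {p q m x : ℝ} (hp : 0 ≤ p) (hpq : p ≤ q) (hm : primitive g q = primitive g p + m * (q - p))
    (hqx : q ≤ x) (hx : x ≤ 1) :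
    primitive (constOn g p q m) x = primitive g x := by
  have hq0 : q ∈ Icc (0 : ℝ) 1 := ⟨hp.trans hpq, hqx.trans hx⟩
  have hx0 : x ∈ Icc (0 : ℝ) 1 := ⟨hq0.1.trans hqx, hx⟩
  have h := primitive_sub (intervalIntegrable_constOn hg p q m) hq0 hx0
  have h' : ∫ y in q..x, constOn g p q m y = ∫ y in q..x, g y :=
    intervalIntegral.integral_congr_uIoo fun y hy => by
      rw [uIoo_of_le hqx] at hy
      exact constOn_of_notMem fun h => by linarith [hy.1, h.2]
  rw [h', ← primitive_sub hg hq0 hx0, primitive_constOn_of_mem hg hp hq0.2 ⟨hpq, le_rfl⟩] at h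
  linarith

theorem integral_sub_constOn (φ g : ℝ → ℝ) {p q : ℝ} (m : ℝ) (hp : 0 ≤ p) (hq : q ≤ 1) :
    ∫ x, (φ (g x) - φ (constOn g p q m x)) ∂lebUnit = ∫ x in Ioc p q, (φ (g x) - φ m) := by
  rw [← lebUnit_restrict_Ioc hp hq, ← integral_indicator measurableSet_Ioc]
  congr 1 with x
  by_cases hx : x ∈ Ioc p q
  · simp [hx, constOn_of_mem hx]
  · simp [hx, constOn_of_notMem hx]

/-- A primitive in the tube is taut if its derivative is constant on any interval on which
replacing the derivative by its mean does not leave the tube. -/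
theorem isTaut_primitive {F g : ℝ → ℝ} {α : ℝ} (hg : IntervalIntegrable g volume 0 1)
    (htube : ∀ x ∈ Icc (0 : ℝ) 1, |primitive g x - F x| ≤ α) (hone : primitive g 1 = F 1)
    (hconst : ∀ p q m : ℝ, 0 ≤ p → p < q → q ≤ 1 →
      primitive g q = primitive g p + m * (q - p) →
      (∀ x ∈ Icc (0 : ℝ) 1, |primitive (constOn g p q m) x - F x| ≤ α) →
      primitive (constOn g p q m) 1 = F 1 →
      ∀ᵐ x ∂(volume.restrict (Ioc p q)), g x = m) :
    IsTaut F α (primitive g) where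
  continuousOn := continuousOn_primitive hg
  zero := primitive_zero g
  one := hone
  mem_tube := htube
  eq_chord p q m hp hpq hq hm hch x hx := by
    have hae := hconst p q m hp hpq hq hm (fun y hy => ?_)
      (by rw [primitive_constOn_of_ge hg hp hpq.le hm hq le_rfl, hone])
    · have h := primitive_sub hg (a := p) (b := x)
        ⟨hp, hpq.le.trans hq⟩ ⟨hp.trans hx.1, hx.2.trans hq⟩
      rw [intervalIntegral.integral_of_le hx.1, setIntegral_congr_ae (g := fun _ => m)
        measurableSet_Ioc ?_, ← intervalIntegral.integral_of_le hx.1,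
        intervalIntegral.integral_const, smul_eq_mul] at h
      · linarith
      · filter_upwards [(ae_restrict_iff' measurableSet_Ioc).1 hae] with y hy hyx
        exact hy ⟨hyx.1, hyx.2.trans hx.2⟩
    -- Since `m` is the mean slope, the modified primitive follows the chord on `[p,q]` and is
    -- unchanged elsewhere.
    · rcases le_total y p with hyp | hpy
      · rw [primitive_constOn_of_le hy.1 hyp]
        exact htube y hy
      rcases le_total y q with hyq | hqy
      · rw [primitive_constOn_of_mem hg hp hq ⟨hpy, hyq⟩]
        exact hch y ⟨hpy, hyq⟩
      · rw [primitive_constOn_of_ge hg hp hpq.le hm hqy hy.2]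
        exact htube y hy

/-! ### Jensen's inequality and tautness of the string -/

/-- The equality case of Jensen's inequality for an integrand that lies strictly above its tangent
at the mean value. -/
theorem ae_eq_mean_of_integral_le {g φ : ℝ → ℝ} (hg : IntervalIntegrable g volume 0 1)
    {p q m c : ℝ} (hp : 0 ≤ p) (hpq : p ≤ q) (hq : q ≤ 1)
    (hφg : Integrable (fun x => φ (g x)) lebUnit)
    (hm : primitive g q = primitive g p + m * (q - p))
    (hφ : ∀ s, c * (s - m) ≤ φ s - φ m) (hφ' : ∀ s, φ s - φ m = c * (s - m) → s = m)
    (hle : ∫ x in Ioc p q, (φ (g x) - φ m) ≤ 0) :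
    ∀ᵐ x ∂(volume.restrict (Ioc p q)), g x = m := by
  have hgi : Integrable g (volume.restrict (Ioc p q)) := by
    rw [← lebUnit_restrict_Ioc hp hq]
    exact (integrable_lebUnit_iff.2 hg).restrict
  have hφi : Integrable (fun x => φ (g x)) (volume.restrict (Ioc p q)) := by
    rw [← lebUnit_restrict_Ioc hp hq]
    exact hφg.restrict
  -- The tangent term integrates to zero because `m` is the mean of `g`, leaving a nonnegative
  -- integrand.
  have hmean : ∫ x in Ioc p q, c * (g x - m) = 0 := by
    have h := primitive_sub hg (a := p) (b := q) ⟨hp, hpq.trans hq⟩ ⟨hp.trans hpq, hq⟩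
    rw [intervalIntegral.integral_of_le hpq] at h
    rw [integral_const_mul, integral_sub hgi (integrable_const m), ← h, hm]
    simp [hpq, mul_comm]
  have hint : Integrable (fun x => (φ (g x) - φ m) - c * (g x - m))
      (volume.restrict (Ioc p q)) :=
    (hφi.sub (integrable_const _)).sub ((hgi.sub (integrable_const _)).const_mul _)
  have h0 : 0 ≤ fun x => (φ (g x) - φ m) - c * (g x - m) := fun x => sub_nonneg.2 (hφ (g x))
  have hz : ∫ x in Ioc p q, ((φ (g x) - φ m) - c * (g x - m)) = 0 := by
    refine le_antisymm ?_ (integral_nonneg h0)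
    have h := integral_sub (f := fun x => φ (g x) - φ m) (g := fun x => c * (g x - m))
      (hφi.sub (integrable_const _)) ((hgi.sub (integrable_const _)).const_mul c)
    rw [h, hmean, sub_zero]
    exact hle
  filter_upwards [(integral_eq_zero_iff_of_nonneg h0 hint).1 hz] with x hx
  exact hφ' _ (sub_eq_zero.1 hx)

theorem sqrt_one_add_sq_tangent (m s : ℝ) :
    m / √(1 + m ^ 2) * (s - m) ≤ √(1 + s ^ 2) - √(1 + m ^ 2) ∧
      (√(1 + s ^ 2) - √(1 + m ^ 2) = m / √(1 + m ^ 2) * (s - m) → s = m) := by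
  set A := √(1 + m ^ 2) with hA
  set B := √(1 + s ^ 2) with hB
  have hA2 : A * A = 1 + m ^ 2 := Real.mul_self_sqrt (by positivity)
  have hB2 : B * B = 1 + s ^ 2 := Real.mul_self_sqrt (by positivity)
  have hA0 : 0 < A := Real.sqrt_pos.2 (by positivity)
  have hB0 : 0 < B := Real.sqrt_pos.2 (by positivity)
  -- Lagrange's identity for `(1, m)` and `(1, s)`: it gives Cauchy-Schwarz together with its
  -- equality case.
  have hsq : (A * B) ^ 2 = (1 + m * s) ^ 2 + (m - s) ^ 2 := by
    calc (A * B) ^ 2 = (A * A) * (B * B) := by ring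
      _ = _ := by rw [hA2, hB2]; ring
  rw [div_mul_eq_mul_div, div_le_iff₀ hA0, eq_div_iff hA0.ne']
  constructor
  · have : 1 + m * s ≤ A * B := le_of_sq_le_sq (by nlinarith [sq_nonneg (m - s)]) (by positivity)
    nlinarith
  · intro h
    have : A * B = 1 + m * s := by nlinarith
    rw [this] at hsq
    have : (m - s) ^ 2 = 0 := by linarith
    linarith [pow_eq_zero_iff (two_ne_zero) |>.1 this]

theorem integrable_sqrt_one_add_sq {g : ℝ → ℝ} (hg : Integrable g lebUnit) :
    Integrable (fun x => √(1 + g x ^ 2)) lebUnit := by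
  refine ((integrable_const (1 : ℝ)).add hg.abs).mono'
    (Real.continuous_sqrt.comp_aestronglyMeasurable
      (aestronglyMeasurable_const.add (hg.aestronglyMeasurable.pow 2))) (ae_of_all _ fun x => ?_)
  rw [Real.norm_of_nonneg (Real.sqrt_nonneg _)]
  refine Real.sqrt_le_iff.2 ⟨by simp only [Pi.add_apply]; positivity, ?_⟩
  simp only [Pi.add_apply]
  nlinarith [abs_nonneg (g x), sq_abs (g x)]

theorem deriv_primitive_ae_eq {g : ℝ → ℝ} (hg : IntervalIntegrable g volume 0 1) :
    deriv (primitive g) =ᵐ[lebUnit] g := by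
  refine (ae_restrict_iff' measurableSet_Ioo).2 ?_
  filter_upwards [hg.ae_hasDerivAt_integral] with x hx hx01
  rw [uIcc_of_le zero_le_one] at hx
  exact (hx (Ioo_subset_Icc_self hx01) 0 (by simp)).deriv

/-- An admissible function for the taut string problem is the primitive of its derivative. -/
theorem IsAdmissible.eqOn_primitive_deriv {f U : ℝ → ℝ} {α : ℝ} (hU : IsAdmissible f α U) :
    EqOn U (primitive (deriv U)) (Icc 0 1) := by
  intro x hx
  have hac : AbsolutelyContinuousOnInterval U 0 x :=
    hU.1.mono (by rw [uIcc_of_le zero_le_one, uIcc_of_le hx.1]; exact Icc_subset_Icc_right hx.2)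
  rw [primitive, hac.integral_deriv_eq_sub, hU.2.2.1, sub_zero]

theorem isAdmissible_primitive {f g : ℝ → ℝ} {α : ℝ} (hg : IntervalIntegrable g volume 0 1)
    (htube : ∀ x ∈ Icc (0 : ℝ) 1, |primitive g x - primitive f x| ≤ α)
    (hone : primitive g 1 = primitive f 1) : IsAdmissible f α (primitive g) :=
  ⟨hg.absolutelyContinuousOnInterval_intervalIntegral (by simp),
    fun x hx => htube x (Ioo_subset_Icc_self hx), primitive_zero g, hone⟩

theorem IsTautStringSolution.isTaut {f U : ℝ → ℝ} {α : ℝ} (hα : 0 ≤ α)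
    (hU : IsTautStringSolution f α U) : IsTaut (primitive f) α (primitive (deriv U)) := by
  have hg : IntervalIntegrable (deriv U) volume 0 1 := hU.1.1.intervalIntegrable_deriv
  have heq := hU.1.eqOn_primitive_deriv
  refine isTaut_primitive hg (fun x hx => ?_) ?_ ?_
  · rw [← heq hx]
    rcases eq_or_lt_of_le hx.1 with rfl | h0
    · simpa [hU.1.2.2.1] using hα
    rcases eq_or_lt_of_le hx.2 with rfl | h1
    · simpa [hU.1.2.2.2] using hα
    exact hU.1.2.1 x ⟨h0, h1⟩
  · rw [← heq (by simp), hU.1.2.2.2]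
  · intro p q m hp hpq hq hm htube hone
    have hk := intervalIntegrable_constOn hg p q m
    have hmin := hU.2 _ (isAdmissible_primitive hk htube hone)
    have hlen : graphLength (primitive (constOn (deriv U) p q m)) =
        ∫ x, √(1 + constOn (deriv U) p q m x ^ 2) ∂lebUnit :=
      integral_congr_ae ((deriv_primitive_ae_eq hk).mono fun x hx => by simp only [hx])
    rw [hlen, graphLength] at hmin
    refine ae_eq_mean_of_integral_le (φ := fun s => √(1 + s ^ 2)) (c := m / √(1 + m ^ 2)) hg hp
      hpq.le hq (integrable_sqrt_one_add_sq (integrable_lebUnit_iff.2 hg)) hm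
      (fun s => (sqrt_one_add_sq_tangent m s).1) (fun s => (sqrt_one_add_sq_tangent m s).2) ?_
    rw [← integral_sub_constOn (fun s => √(1 + s ^ 2)) (deriv U) m hp hq, integral_sub
      (integrable_sqrt_one_add_sq (integrable_lebUnit_iff.2 hg))
      (integrable_sqrt_one_add_sq (integrable_lebUnit_iff.2 hk))]
    linarith

/-! ### Estimates in `L²(0,1)` -/

/-- Continuous functions compactly supported in `(0,1)` are dense in `L²(0,1)`. -/
theorem exists_continuous_integral_sq_le {g : ℝ → ℝ} (hg : MemLp g 2 lebUnit) {ε : ℝ}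
    (hε : 0 < ε) :
    ∃ h : ℝ → ℝ, Continuous h ∧ HasCompactSupport h ∧ tsupport h ⊆ Ioo 0 1 ∧
      ∫ x, (g x - h x) ^ 2 ∂lebUnit ≤ ε := by
  have hms : MeasurableSet (Ioo (0 : ℝ) 1) := measurableSet_Ioo
  have : LocallyCompactSpace (Ioo (0 : ℝ) 1) := isOpen_Ioo.locallyCompactSpace
  -- Approximating on the open interval as a space of its own keeps the supports compact inside
  -- `(0,1)`; the result is then extended by zero.
  set μ : Measure (Ioo (0 : ℝ) 1) := Measure.comap Subtype.val volume with hμ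
  have hmap : Measure.map Subtype.val μ = lebUnit := map_comap_subtype_coe hms volume
  have hemb := MeasurableEmbedding.subtype_coe hms
  have : IsFiniteMeasure μ := by
    constructor
    have h1 : lebUnit univ < ∞ := measure_lt_top _ _
    rwa [← hmap, hemb.map_apply, preimage_univ] at h1
  have hg' : MemLp (fun x : Ioo (0 : ℝ) 1 => g x) (ENNReal.ofReal 2) μ := by
    rw [← hmap, hemb.memLp_map_measure_iff] at hg
    simpa [Function.comp_def] using hg
  obtain ⟨k, hks, hkε, hkc, -⟩ := hg'.exists_hasCompactSupport_integral_rpow_sub_le two_pos hε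
  refine ⟨Function.extend Subtype.val k 0, hks.continuous_extend_zero isOpen_Ioo hkc,
    hks.extend_zero continuous_subtype_val,
    (hks.tsupport_extend_zero_subset continuous_subtype_val).trans (Subtype.coe_image_subset _ _),
    ?_⟩
  rw [← hmap, hemb.integral_map]
  refine le_trans (le_of_eq (integral_congr_ae (ae_of_all _ fun x => ?_))) hkε
  simp

theorem integrable_fun_mul {a b : ℝ → ℝ} (ha : MemLp a 2 lebUnit) (hb : MemLp b 2 lebUnit) :
    Integrable (fun x => a x * b x) lebUnit :=
  ha.integrable_mul hb

theorem intervalIntegrable_of_memLp {g : ℝ → ℝ} (hg : MemLp g 2 lebUnit) :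
    IntervalIntegrable g volume 0 1 :=
  integrable_lebUnit_iff.1 (hg.integrable one_le_two)

theorem primitive_sub_const_mul {a b : ℝ → ℝ} (c : ℝ) {x : ℝ} (ha : MemLp a 2 lebUnit)
    (hb : MemLp b 2 lebUnit) (hx : x ∈ Icc (0 : ℝ) 1) :
    primitive (fun y => a y - c * b y) x = primitive a x - c * primitive b x := by
  rw [primitive, intervalIntegral.integral_sub
    ((intervalIntegrable_of_memLp ha).mono_unit (by simp) hx)
    (((intervalIntegrable_of_memLp hb).mono_unit (by simp) hx).const_mul c),
    intervalIntegral.integral_const_mul]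
  rfl

theorem primitive_fun_sub {a b : ℝ → ℝ} {x : ℝ} (ha : MemLp a 2 lebUnit)
    (hb : MemLp b 2 lebUnit) (hx : x ∈ Icc (0 : ℝ) 1) :
    primitive (fun y => a y - b y) x = primitive a x - primitive b x := by
  simpa using primitive_sub_const_mul 1 ha hb hx

/-- A form of the Cauchy-Schwarz inequality. -/
theorem abs_integral_mul_le {a b : ℝ → ℝ} (ha : MemLp a 2 lebUnit) (hb : MemLp b 2 lebUnit)
    {ε : ℝ} (hε : 0 < ε) (hbε : ∫ x, b x ^ 2 ∂lebUnit ≤ ε ^ 2) :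
    |∫ x, a x * b x ∂lebUnit| ≤ ε * ((∫ x, a x ^ 2 ∂lebUnit) + 1) / 2 := by
  have hb2 := hb.integrable_sq
  have ha2 := ha.integrable_sq
  calc |∫ x, a x * b x ∂lebUnit| ≤ ∫ x, |a x * b x| ∂lebUnit := abs_integral_le_integral_abs
    -- Young's inequality with weight `ε`.
    _ ≤ ∫ x, (ε / 2 * a x ^ 2 + (2 * ε)⁻¹ * b x ^ 2) ∂lebUnit := by
        refine integral_mono (integrable_fun_mul ha hb).abs
          ((ha2.const_mul _).add (hb2.const_mul _)) fun x => ?_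
        rw [abs_mul, ← sq_abs (a x), ← sq_abs (b x)]
        have h1 : ε / 2 * |a x| ^ 2 + (2 * ε)⁻¹ * |b x| ^ 2 - |a x| * |b x|
            = (2 * ε)⁻¹ * (ε * |a x| - |b x|) ^ 2 := by
          field_simp
          ring
        have h2 : 0 ≤ (2 * ε)⁻¹ * (ε * |a x| - |b x|) ^ 2 := by positivity
        linarith
    _ = ε / 2 * (∫ x, a x ^ 2 ∂lebUnit) + (2 * ε)⁻¹ * ∫ x, b x ^ 2 ∂lebUnit := by
        rw [integral_add (ha2.const_mul _) (hb2.const_mul _), integral_const_mul,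
          integral_const_mul]
    _ ≤ ε / 2 * (∫ x, a x ^ 2 ∂lebUnit) + (2 * ε)⁻¹ * ε ^ 2 := by gcongr
    _ = _ := by field_simp

theorem primitive_eq_integral_indicator (g : ℝ → ℝ) {x : ℝ} (hx : x ∈ Icc (0 : ℝ) 1) :
    primitive g x = ∫ y, (Ioc 0 x).indicator 1 y * g y ∂lebUnit := by
  rw [primitive, intervalIntegral.integral_of_le hx.1, ← lebUnit_restrict_Ioc le_rfl hx.2,
    ← integral_indicator measurableSet_Ioc]
  congr 1 with y
  by_cases hy : y ∈ Ioc 0 x <;> simp [hy]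

theorem memLp_indicator_Ioc (x : ℝ) : MemLp ((Ioc 0 x).indicator (1 : ℝ → ℝ)) 2 lebUnit :=
  (memLp_const (1 : ℝ)).indicator measurableSet_Ioc

theorem abs_primitive_le {b : ℝ → ℝ} (hb : MemLp b 2 lebUnit)
    {ε : ℝ} (hε : 0 < ε) (hbε : ∫ x, b x ^ 2 ∂lebUnit ≤ ε ^ 2) {x : ℝ} (hx : x ∈ Icc (0 : ℝ) 1) :
    |primitive b x| ≤ ε := by
  rw [primitive_eq_integral_indicator b hx]
  refine (abs_integral_mul_le (memLp_indicator_Ioc x) hb hε hbε).trans ?_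
  have : ∫ y, (Ioc 0 x).indicator (1 : ℝ → ℝ) y ^ 2 ∂lebUnit ≤ ∫ _, (1 : ℝ) ∂lebUnit := by
    refine integral_mono (memLp_indicator_Ioc x).integrable_sq (integrable_const _) fun y => ?_
    by_cases hy : y ∈ Ioc 0 x <;> simp [hy]
  simp only [integral_const, probReal_univ, smul_eq_mul, mul_one] at this
  nlinarith

/-! ### Total variation and duality -/

theorem IsTestField.integrable_mul_deriv {u ψ : ℝ → ℝ} (hψ : IsTestField ψ)
    (hu : Integrable u lebUnit) : Integrable (fun x => u x * deriv ψ x) lebUnit :=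
  hu.mul_of_top_left
    (((hψ.1.continuous_deriv le_rfl).memLp_of_hasCompactSupport hψ.2.1.deriv))

theorem isTestField_zero : IsTestField fun _ => 0 :=
  ⟨contDiff_const, HasCompactSupport.zero, by simp [tsupport], by simp⟩

theorem IsTestField.integral_le {u ψ : ℝ → ℝ} (hψ : IsTestField ψ) (hu : totalVar u ≠ ∞) :
    ∫ x, u x * deriv ψ x ∂lebUnit ≤ (totalVar u).toReal :=
  (ENNReal.ofReal_le_iff_le_toReal hu).1
    (le_iSup₂ (f := fun ψ (_ : IsTestField ψ) =>
      ENNReal.ofReal (∫ x, u x * deriv ψ x ∂lebUnit)) ψ hψ)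

theorem totalVar_le {u : ℝ → ℝ} {B : ℝ}
    (h : ∀ ψ, IsTestField ψ → ∫ x, u x * deriv ψ x ∂lebUnit ≤ B) :
    totalVar u ≤ ENNReal.ofReal B :=
  iSup₂_le fun ψ hψ => ENNReal.ofReal_le_ofReal (h ψ hψ)

theorem IsTestField.eq_zero {ψ : ℝ → ℝ} (hψ : IsTestField ψ) {x : ℝ} (hx : x ∉ Ioo (0 : ℝ) 1) :
    ψ x = 0 :=
  image_eq_zero_of_notMem_tsupport fun h => hx (hψ.2.2.1 h)

theorem exists_Icc_of_isCompact_subset_Ioo {K : Set ℝ} (hK : IsCompact K)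
    (hs : K ⊆ Ioo (0 : ℝ) 1) : ∃ a b : ℝ, 0 < a ∧ b < 1 ∧ K ⊆ Icc a b := by
  rcases K.eq_empty_or_nonempty with rfl | hne
  · exact ⟨1, 0, one_pos, zero_lt_one, empty_subset _⟩
  obtain ⟨a, haK, ha⟩ := hK.exists_isLeast hne
  obtain ⟨b, hbK, hb⟩ := hK.exists_isGreatest hne
  exact ⟨a, b, (hs haK).1, (hs hbK).2, fun x hx => ⟨ha hx, hb hx⟩⟩

/-- The duality between total variation and test fields, for the primitive of a continuous
function. -/
theorem integral_mul_le_of_continuous {u h : ℝ → ℝ} {β : ℝ} (hu : totalVar u ≠ ∞) (hβ : 0 < β)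
    (hc : Continuous h) (hK : HasCompactSupport h) (hs : tsupport h ⊆ Ioo 0 1)
    (h1 : primitive h 1 = 0) (hb : ∀ x ∈ Icc (0 : ℝ) 1, |primitive h x| ≤ β) :
    ∫ x, u x * h x ∂lebUnit ≤ β * (totalVar u).toReal := by
  obtain ⟨a, b, ha, hb1, hab⟩ := exists_Icc_of_isCompact_subset_Ioo hK hs
  have hout : ∀ x, x ∉ Icc a b → h x = 0 := fun x hx =>
    image_eq_zero_of_notMem_tsupport fun hx' => hx (hab hx')
  have hP : ∀ x, HasDerivAt (primitive h) (h x) x := fun x =>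
    (hc.integral_hasStrictDerivAt 0 x).hasDerivAt
  have hPout : ∀ x, x ∉ Icc a b → primitive h x = 0 := by
    intro x hx
    rcases lt_or_ge x a with hxa | hax
    · refine (intervalIntegral.integral_congr (g := fun _ => (0 : ℝ)) fun y hy => ?_).trans
        (by simp)
      have : y < a := lt_of_le_of_lt hy.2 (by simp [hxa, ha])
      exact hout y fun hy' => this.not_ge hy'.1
    · have hbx : b < x := lt_of_not_ge fun hxb => hx ⟨hax, hxb⟩
      have hadd : primitive h 1 + ∫ y in (1 : ℝ)..x, h y = primitive h x :=
        intervalIntegral.integral_add_adjacent_intervals (hc.intervalIntegrable _ _)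
          (hc.intervalIntegrable _ _)
      have hz : ∫ y in (1 : ℝ)..x, h y = 0 := by
        refine (intervalIntegral.integral_congr (g := fun _ => (0 : ℝ)) fun y hy => ?_).trans
          (by simp)
        have : b < y := lt_of_lt_of_le (by simp [hbx, hb1]) hy.1
        exact hout y fun hy' => this.not_ge hy'.2
      rw [← hadd, h1, hz, add_zero]
  have hsupp : (Function.support fun x => β⁻¹ * primitive h x) ⊆ Icc a b := fun x hx => by
    by_contra hx'
    exact hx (by simp [hPout x hx'])
  have hψd : ∀ x, HasDerivAt (fun x => β⁻¹ * primitive h x) (β⁻¹ * h x) x := fun x =>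
    (hP x).const_mul _
  have hder : deriv (fun x => β⁻¹ * primitive h x) = fun x => β⁻¹ * h x :=
    funext fun x => (hψd x).deriv
  have htest : IsTestField fun x => β⁻¹ * primitive h x := by
    refine ⟨contDiff_one_iff_deriv.2 ⟨fun x => (hψd x).differentiableAt, ?_⟩,
      .of_support_subset_isCompact isCompact_Icc hsupp,
      (closure_minimal hsupp isClosed_Icc).trans fun x hx =>
        ⟨ha.trans_le hx.1, hx.2.trans_lt hb1⟩, fun x => ?_⟩
    · rw [hder]; fun_prop
    · by_cases hx : x ∈ Icc a b
      · rw [abs_mul, abs_of_pos (inv_pos.2 hβ), inv_mul_le_iff₀ hβ, mul_one]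
        exact hb x ⟨ha.le.trans hx.1, hx.2.trans hb1.le⟩
      · simp [hPout x hx]
  have := htest.integral_le hu
  rw [hder] at this
  have heq : ∫ x, u x * h x ∂lebUnit = β * ∫ x, u x * (β⁻¹ * h x) ∂lebUnit := by
    rw [← integral_const_mul]
    congr 1 with x
    field_simp
  rw [heq]
  gcongr

/-- The duality between total variation and vector fields with square integrable divergence. -/
theorem integral_mul_le_totalVar {u g : ℝ → ℝ} {α : ℝ} (hα : 0 ≤ α) (hu : MemLp u 2 lebUnit)
    (hTV : totalVar u ≠ ∞) (hg : MemLp g 2 lebUnit) (h1 : primitive g 1 = 0)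
    (hb : ∀ x ∈ Icc (0 : ℝ) 1, |primitive g x| ≤ α) :
    ∫ x, u x * g x ∂lebUnit ≤ α * (totalVar u).toReal := by
  have hmem : ∀ {h : ℝ → ℝ}, Continuous h → HasCompactSupport h → MemLp h 2 lebUnit :=
    fun hc hK => hc.memLp_of_hasCompactSupport hK
  have h01 : (1 : ℝ) ∈ Icc (0 : ℝ) 1 := by simp
  -- A fixed `ρ` with positive integral, obtained by approximating `1`; it serves to correct the
  -- mean of the approximants of `g`.
  obtain ⟨ρ, hρc, hρK, hρs, hρ⟩ :=
    exists_continuous_integral_sq_le (g := fun _ => 1) (memLp_const 1)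
      (show (0 : ℝ) < (1 / 2) ^ 2 by norm_num)
  have hρ2 := hmem hρc hρK
  have hρ1 : 0 < primitive ρ 1 := by
    have := abs_primitive_le ((memLp_const (1 : ℝ)).sub hρ2) (show (0 : ℝ) < 1 / 2 by norm_num)
      hρ h01
    have h' : primitive ((fun _ => (1 : ℝ)) - ρ) 1 = 1 - primitive ρ 1 := by
      have := primitive_fun_sub (a := fun _ => (1 : ℝ)) (memLp_const 1) hρ2 h01
      rw [show primitive (fun _ => (1 : ℝ)) 1 = 1 by simp [primitive]] at this
      exact this
    rw [h'] at this
    linarith [(abs_le.1 this).2]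
  obtain ⟨C, hC⟩ :=
    isCompact_Icc.exists_bound_of_continuousOn (continuousOn_primitive (intervalIntegrable_of_memLp hρ2))
  simp only [Real.norm_eq_abs] at hC
  have hC0 : 0 ≤ C := (abs_nonneg _).trans (hC 1 h01)
  set R := primitive ρ 1 with hR
  set T := (totalVar u).toReal with hT
  have hT0 : 0 ≤ T := ENNReal.toReal_nonneg
  set A := ∫ x, u x ^ 2 ∂lebUnit with hA
  set Q := |∫ x, u x * ρ x ∂lebUnit| with hQ
  have key : ∀ ε > 0, ∫ x, u x * g x ∂lebUnit
      ≤ α * T + ε * ((1 + C / R) * T + (A + 1) / 2 + Q / R) := by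
    intro ε hε
    obtain ⟨h, hc, hK, hs, hgh⟩ :=
      exists_continuous_integral_sq_le hg (show 0 < ε ^ 2 by positivity)
    have hh2 := hmem hc hK
    have hP : ∀ x ∈ Icc (0 : ℝ) 1, |primitive g x - primitive h x| ≤ ε := fun x hx => by
      rw [← primitive_fun_sub hg hh2 hx]
      exact abs_primitive_le (hg.sub hh2) hε hgh hx
    -- This makes the integral of `h - c * ρ` vanish. It is small since `g` has integral zero and
    -- `h` is close to `g`.
    set c := primitive h 1 / R with hcdef
    have hcε : |c| ≤ ε / R := by
      have := hP 1 h01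
      rw [h1, zero_sub, abs_neg] at this
      rw [hcdef, abs_div, abs_of_pos hρ1]
      gcongr
    -- The bound exceeds `α` by `ε` from approximating `g` and by `ε / R * C` from the correction.
    have htest := integral_mul_le_of_continuous (u := u) (h := fun x => h x - c * ρ x)
      (β := α + ε * (1 + C / R)) hTV (by positivity) (by fun_prop)
      (hK.sub (hρK.mul_left)) ((tsupport_sub _ _).trans (union_subset hs
        ((tsupport_mul_subset_right).trans hρs)))
      (by rw [primitive_sub_const_mul c hh2 hρ2 h01, hcdef, ← hR,
        div_mul_cancel₀ _ hρ1.ne', sub_self])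
      (fun x hx => by
        rw [primitive_sub_const_mul c hh2 hρ2 hx]
        have e1 := abs_le.1 (hP x hx)
        have e2 := abs_le.1 (hb x hx)
        have e3 : |c * primitive ρ x| ≤ ε / R * C := by
          rw [abs_mul]
          exact mul_le_mul hcε (hC x hx) (abs_nonneg _) (by positivity)
        have e4 := abs_le.1 e3
        have e5 : ε / R * C = ε * (C / R) := by ring
        rw [abs_le]
        constructor <;> linarith [e1.1, e1.2, e2.1, e2.2, e4.1, e4.2])
    have e1 : ∫ x, u x * (h x - c * ρ x) ∂lebUnit
        = (∫ x, u x * h x ∂lebUnit) - c * ∫ x, u x * ρ x ∂lebUnit := by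
      rw [← integral_const_mul, ← integral_sub (integrable_fun_mul hu hh2)
        ((integrable_fun_mul hu hρ2).const_mul c)]
      congr 1 with x
      ring
    have e2 : ∫ x, u x * (g x - h x) ∂lebUnit
        = (∫ x, u x * g x ∂lebUnit) - ∫ x, u x * h x ∂lebUnit := by
      rw [← integral_sub (integrable_fun_mul hu hg) (integrable_fun_mul hu hh2)]
      congr 1 with x
      ring
    have e3 := (abs_le.1 (abs_integral_mul_le hu (hg.sub hh2) hε hgh)).2
    simp only [Pi.sub_apply] at e3
    have e4 : |c * ∫ x, u x * ρ x ∂lebUnit| ≤ ε / R * Q := by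
      rw [abs_mul]
      exact mul_le_mul_of_nonneg_right hcε (abs_nonneg _)
    have e5 := (abs_le.1 e4).2
    have e6 : ε / R * Q = ε * (Q / R) := by ring
    have e7 : ε * ((1 + C / R) * T + (A + 1) / 2 + Q / R)
        = ε * (1 + C / R) * T + ε * (A + 1) / 2 + ε * (Q / R) := by ring
    linarith
  have hlim : Tendsto (fun ε : ℝ => α * T + ε * ((1 + C / R) * T + (A + 1) / 2 + Q / R))
      (𝓝[>] 0) (𝓝 (α * T + 0 * ((1 + C / R) * T + (A + 1) / 2 + Q / R))) :=
    Tendsto.mono_left (Continuous.tendsto (by fun_prop) 0) nhdsWithin_le_nhds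
  rw [zero_mul, add_zero] at hlim
  exact ge_of_tendsto hlim (eventually_mem_nhdsWithin.mono fun ε hε => key ε hε)

/-! ### Optimality conditions for ROF and tautness of its primitive -/

theorem half_eLpNorm_two_sq {h : ℝ → ℝ} (hh : MemLp h 2 lebUnit) :
    2⁻¹ * eLpNorm h 2 lebUnit ^ 2 = ENNReal.ofReal ((∫ x, h x ^ 2 ∂lebUnit) / 2) := by
  have h1 := eLpNorm_nnreal_pow_eq_lintegral (f := h) (μ := lebUnit) (p := 2) two_ne_zero
  have h2 : eLpNorm h 2 lebUnit ^ 2 = ENNReal.ofReal (∫ x, h x ^ 2 ∂lebUnit) := by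
    rw [ofReal_integral_eq_lintegral_ofReal hh.integrable_sq (ae_of_all _ fun x => sq_nonneg _)]
    have h3 : ∀ x, ENNReal.ofReal (h x ^ 2) = ‖h x‖ₑ ^ (2 : ℝ) := fun x => by
      rw [← ofReal_norm, ENNReal.rpow_ofNat, ← ENNReal.ofReal_pow (norm_nonneg _),
        Real.norm_eq_abs, sq_abs]
    simp only [h3]
    simpa using h1
  rw [h2, div_eq_inv_mul, ENNReal.ofReal_mul (by norm_num), ENNReal.ofReal_inv_of_pos two_pos,
    ENNReal.ofReal_ofNat]

/-- Comparison with the competitor `0` makes the energy finite, hence `u - f` square integrable. -/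
theorem IsROFSolution.memLp_two {f u : ℝ → ℝ} {α : ℝ} (hf : MemLp f 2 lebUnit)
    (hu : IsROFSolution f α u) : MemLp u 2 lebUnit := by
  have hTV0 : totalVar (fun _ => 0) = 0 := by
    refine le_antisymm ((totalVar_le (B := 0) fun ψ _ => by simp).trans (by simp)) zero_le
  have hle := hu.2 (fun _ => 0) ⟨integrable_zero _ _ _, by simp [hTV0]⟩
  have hfin : rofEnergy f α (fun _ => 0) < ∞ := by
    have hf' : MemLp (fun x => 0 - f x) 2 lebUnit := (memLp_const 0).sub hf
    rw [rofEnergy, hTV0, half_eLpNorm_two_sq hf']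
    simp
  have hd : MemLp (fun x => u x - f x) 2 lebUnit := by
    refine ⟨hu.1.1.aestronglyMeasurable.sub hf.aestronglyMeasurable, lt_top_iff_ne_top.2 ?_⟩
    intro htop
    refine (hle.trans_lt hfin).ne ?_
    rw [rofEnergy, htop]
    simp
  exact (hd.add hf).ae_eq (ae_of_all _ fun x => by simp)

/-- The Euler-Lagrange inequality of the ROF problem: if the total variation grows at most at rate
`K` in direction `φ`, then `∫ (f - u) φ ≤ α K`. -/
theorem IsROFSolution.integral_sub_mul_le {f u φ : ℝ → ℝ} {α K : ℝ} (hα : 0 ≤ α)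
    (hf : MemLp f 2 lebUnit) (hu : IsROFSolution f α u) (hφ : MemLp φ 2 lebUnit)
    (hK : ∀ t ∈ Ioo (0 : ℝ) 1, ∀ ψ, IsTestField ψ →
      ∫ x, (u x + t * φ x) * deriv ψ x ∂lebUnit ≤ (totalVar u).toReal + t * K) :
    ∫ x, (f x - u x) * φ x ∂lebUnit ≤ α * K := by
  have hu2 := hu.memLp_two hf
  have hd : MemLp (fun x => f x - u x) 2 lebUnit := hf.sub hu2
  have hd' : MemLp (fun x => u x - f x) 2 lebUnit := hu2.sub hf
  set T := (totalVar u).toReal with hT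
  set X := ∫ x, (f x - u x) * φ x ∂lebUnit with hX
  set P := ∫ x, φ x ^ 2 ∂lebUnit with hP
  have key : ∀ t ∈ Ioo (0 : ℝ) 1, X ≤ α * K + t * (P / 2) := by
    intro t ht
    have hB0 : 0 ≤ T + t * K := by simpa using hK t ht _ isTestField_zero
    have hv2 : MemLp (fun x => u x + t * φ x) 2 lebUnit := hu2.add (hφ.const_mul t)
    have hvTV := totalVar_le (hK t ht)
    have hle := hu.2 _ ⟨hv2.integrable one_le_two, hvTV.trans_lt ENNReal.ofReal_lt_top⟩
    have hle' := hle.trans (add_le_add le_rfl (mul_le_mul_right hvTV (ENNReal.ofReal α)))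
    rw [rofEnergy, half_eLpNorm_two_sq hd',
      half_eLpNorm_two_sq (h := fun x => u x + t * φ x - f x) (hv2.sub hf),
      ← ENNReal.ofReal_toReal hu.1.2.ne, ← hT, ← ENNReal.ofReal_mul hα, ← ENNReal.ofReal_mul hα,
      ← ENNReal.ofReal_add (div_nonneg (integral_nonneg fun x => sq_nonneg _) two_pos.le)
        (mul_nonneg hα ENNReal.toReal_nonneg),
      ← ENNReal.ofReal_add (div_nonneg (integral_nonneg fun x => sq_nonneg _) two_pos.le)
        (mul_nonneg hα hB0), ENNReal.ofReal_le_ofReal_iff (add_nonneg (div_nonneg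
        (integral_nonneg fun x => sq_nonneg _) two_pos.le) (mul_nonneg hα hB0))] at hle'
    have hexp : ∫ x, (u x + t * φ x - f x) ^ 2 ∂lebUnit
        = (∫ x, (u x - f x) ^ 2 ∂lebUnit) - 2 * t * X + t ^ 2 * P := by
      rw [hX, hP, ← integral_const_mul, ← integral_const_mul,
        ← integral_sub hd'.integrable_sq ((integrable_fun_mul hd hφ).const_mul _),
        ← integral_add (f := fun x => (u x - f x) ^ 2 - 2 * t * ((f x - u x) * φ x))
          (hd'.integrable_sq.sub ((integrable_fun_mul hd hφ).const_mul _))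
          (hφ.integrable_sq.const_mul _)]
      congr 1 with x
      ring
    rw [hexp] at hle'
    -- Dividing the energy comparison by `t` leaves an error of order `t`, which vanishes in the
    -- limit below.
    refine le_of_mul_le_mul_left ?_ ht.1
    linarith
  have hlim : Tendsto (fun t : ℝ => α * K + t * (P / 2)) (𝓝[>] 0) (𝓝 (α * K + 0 * (P / 2))) :=
    Tendsto.mono_left (Continuous.tendsto (by fun_prop) 0) nhdsWithin_le_nhds
  rw [zero_mul, add_zero] at hlim
  refine ge_of_tendsto hlim ?_
  filter_upwards [Ioo_mem_nhdsGT (zero_lt_one (α := ℝ))] with t ht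
  exact key t ht

theorem IsTestField.integral_indicator_mul_deriv {ψ : ℝ → ℝ} (hψ : IsTestField ψ) {x : ℝ}
    (hx : x ∈ Icc (0 : ℝ) 1) :
    ∫ y, (Ioc 0 x).indicator 1 y * deriv ψ y ∂lebUnit = ψ x := by
  rw [← primitive_eq_integral_indicator _ hx, primitive,
    intervalIntegral.integral_deriv_eq_sub
      (fun y _ => hψ.1.differentiable one_ne_zero y)
      ((hψ.1.continuous_deriv le_rfl).intervalIntegrable _ _), hψ.eq_zero (x := 0) (by simp),
    sub_zero]

/-- The perturbation is `c` times the indicator of `(0,x]`, whose pairing with `ψ'` is `c * ψ x`.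
Taking `c = ±1` yields the tube bound, and `ψ 1 = 0` yields the end condition. -/
theorem IsROFSolution.mul_primitive_sub_le {f u : ℝ → ℝ} {α K c x : ℝ} (hα : 0 ≤ α)
    (hf : MemLp f 2 lebUnit) (hu : IsROFSolution f α u) (hx : x ∈ Icc (0 : ℝ) 1)
    (hc : ∀ ψ, IsTestField ψ → c * ψ x ≤ K) :
    c * (primitive f x - primitive u x) ≤ α * K := by
  have hu2 := hu.memLp_two hf
  have h := hu.integral_sub_mul_le (φ := fun y => c * (Ioc 0 x).indicator 1 y) (K := K) hα hf
    ((memLp_indicator_Ioc x).const_mul c) fun t ht ψ hψ => ?_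
  · rw [← primitive_fun_sub hf hu2 hx, primitive_eq_integral_indicator _ hx,
      ← integral_const_mul]
    refine le_of_eq_of_le (integral_congr_ae (ae_of_all _ fun y => ?_)) h
    ring
  · have hi : Integrable (fun y => (Ioc 0 x).indicator 1 y * deriv ψ y) lebUnit :=
      hψ.integrable_mul_deriv ((memLp_indicator_Ioc x).integrable one_le_two)
    have heq : ∫ y, (u y + t * (c * (Ioc 0 x).indicator 1 y)) * deriv ψ y ∂lebUnit
        = (∫ y, u y * deriv ψ y ∂lebUnit) + t * c * ψ x := by
      rw [← hψ.integral_indicator_mul_deriv hx, ← integral_const_mul,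
        ← integral_add (hψ.integrable_mul_deriv hu.1.1) (hi.const_mul _)]
      congr 1 with y
      ring
    rw [heq, mul_assoc]
    exact add_le_add (hψ.integral_le hu.1.2.ne)
      (mul_le_mul_of_nonneg_left (hc ψ hψ) ht.1.le)

theorem IsROFSolution.primitive_mem_tube {f u : ℝ → ℝ} {α : ℝ} (hα : 0 ≤ α)
    (hf : MemLp f 2 lebUnit) (hu : IsROFSolution f α u) {x : ℝ} (hx : x ∈ Icc (0 : ℝ) 1) :
    |primitive u x - primitive f x| ≤ α := by
  have h1 := hu.mul_primitive_sub_le (c := 1) (K := 1) hα hf hx fun ψ hψ => by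
    linarith [(abs_le.1 (hψ.2.2.2 x)).2]
  have h2 := hu.mul_primitive_sub_le (c := -1) (K := 1) hα hf hx fun ψ hψ => by
    linarith [(abs_le.1 (hψ.2.2.2 x)).1]
  rw [abs_le]
  constructor <;> linarith

theorem IsROFSolution.primitive_one {f u : ℝ → ℝ} {α : ℝ} (hα : 0 ≤ α)
    (hf : MemLp f 2 lebUnit) (hu : IsROFSolution f α u) :
    primitive u 1 = primitive f 1 := by
  have h1 := hu.mul_primitive_sub_le (c := 1) (K := 0) (x := 1) hα hf (by simp) fun ψ hψ => by
    simp [hψ.eq_zero (x := 1) (by simp)]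
  have h2 := hu.mul_primitive_sub_le (c := -1) (K := 0) (x := 1) hα hf (by simp) fun ψ hψ => by
    simp [hψ.eq_zero (x := 1) (by simp)]
  linarith

/-- Shrinking `u` to `(1 - t) * u` lowers the total variation at rate `totalVar u`. -/
theorem IsROFSolution.mul_totalVar_le {f u : ℝ → ℝ} {α : ℝ} (hα : 0 ≤ α)
    (hf : MemLp f 2 lebUnit) (hu : IsROFSolution f α u) :
    α * (totalVar u).toReal ≤ ∫ x, (f x - u x) * u x ∂lebUnit := by
  have h := hu.integral_sub_mul_le (φ := fun x => -u x) (K := -(totalVar u).toReal) hα hf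
    (hu.memLp_two hf).neg fun t ht ψ hψ => by
      have heq : ∫ x, (u x + t * -u x) * deriv ψ x ∂lebUnit
          = (1 - t) * ∫ x, u x * deriv ψ x ∂lebUnit := by
        rw [← integral_const_mul]
        congr 1 with x
        ring
      rw [heq]
      have := mul_le_mul_of_nonneg_left (hψ.integral_le hu.1.2.ne) (sub_nonneg.2 ht.2.le)
      linarith
  simp only [mul_neg, integral_neg] at h
  linarith

/-- The primitive of the solution of the ROF problem is taut. -/
theorem IsROFSolution.isTaut {f u : ℝ → ℝ} {α : ℝ} (hα : 0 ≤ α)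
    (hf : MemLp f 2 lebUnit) (hu : IsROFSolution f α u) :
    IsTaut (primitive f) α (primitive u) := by
  have hu2 := hu.memLp_two hf
  refine isTaut_primitive (intervalIntegrable_of_memLp hu2)
    (fun x hx => hu.primitive_mem_tube hα hf hx) (hu.primitive_one hα hf) ?_
  intro p q m hp hpq hq hm htube hone
  set v := constOn u p q m with hv
  have hv2 : MemLp v 2 lebUnit := memLp_constOn hu2 p q m
  have hdual := integral_mul_le_totalVar (g := fun x => f x - v x) hα hu2 hu.1.2.ne (hf.sub hv2)
    (by rw [primitive_fun_sub hf hv2 (by simp), hone, sub_self])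
    (fun x hx => by rw [primitive_fun_sub hf hv2 hx, abs_sub_comm]; exact htube x hx)
  have hle := hdual.trans (hu.mul_totalVar_le hα hf)
  have hfv : MemLp (fun x => f x - v x) 2 lebUnit := hf.sub hv2
  have hfu : MemLp (fun x => f x - u x) 2 lebUnit := hf.sub hu2
  refine ae_eq_mean_of_integral_le (φ := fun s => s ^ 2) (c := 2 * m)
    (intervalIntegrable_of_memLp hu2) hp hpq.le hq hu2.integrable_sq hm
    (fun s => by nlinarith [sq_nonneg (s - m)]) (fun s hs => ?_) ?_
  · have : (s - m) ^ 2 = 0 := by linarith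
    exact sub_eq_zero.1 (pow_eq_zero_iff two_ne_zero |>.1 this)
  · rw [← integral_sub_constOn (fun s => s ^ 2) u m hp hq, ← hv]
    -- The right integrand is `2 * (u² - u * v)` and exceeds the left one by `(u - v)²`. By `hle`
    -- its integral is at most zero.
    have h1 : ∫ x, (u x ^ 2 - v x ^ 2) ∂lebUnit
        ≤ ∫ x, 2 * (u x * (f x - v x) - (f x - u x) * u x) ∂lebUnit := by
      refine integral_mono (hu2.integrable_sq.sub hv2.integrable_sq)
        (((integrable_fun_mul hu2 hfv).sub
          (integrable_fun_mul hfu hu2)).const_mul 2) fun x => ?_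
      nlinarith [sq_nonneg (u x - v x)]
    rw [integral_const_mul, integral_sub (integrable_fun_mul hu2 hfv)
      (integrable_fun_mul hfu hu2)] at h1
    linarith

/-! ### Approximate limits and jumps -/

theorem hasLeftApproxLim_iff {g : ℝ → ℝ} (hg : IntervalIntegrable g volume 0 1) {x l : ℝ}
    (hx : x ∈ Ioo (0 : ℝ) 1) : HasLeftApproxLim g x l ↔
      Tendsto (fun y => (primitive g x - primitive g y) / (x - y)) (𝓝[<] x) (𝓝 l) := by
  refine tendsto_congr' ?_
  filter_upwards [Ioo_mem_nhdsLT hx.1] with y hy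
  rw [interval_average_eq, primitive_sub hg ⟨hy.1.le, (hy.2.trans hx.2).le⟩
    (Ioo_subset_Icc_self hx), smul_eq_mul, div_eq_inv_mul]

theorem hasRightApproxLim_iff {g : ℝ → ℝ} (hg : IntervalIntegrable g volume 0 1) {x r : ℝ}
    (hx : x ∈ Ioo (0 : ℝ) 1) : HasRightApproxLim g x r ↔
      Tendsto (fun y => (primitive g y - primitive g x) / (y - x)) (𝓝[>] x) (𝓝 r) := by
  refine tendsto_congr' ?_
  filter_upwards [Ioo_mem_nhdsGT hx.2] with y hy
  rw [interval_average_eq, primitive_sub hg (Ioo_subset_Icc_self hx)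
    ⟨(hx.1.trans hy.1).le, hy.2.le⟩, smul_eq_mul, div_eq_inv_mul]

/-- If the primitive of `u` touches that of `f` from below at `x`, up to a constant, then the jump
of `u` at `x` is at most that of `f`. -/
theorem approxLim_le_of_touch {f u : ℝ → ℝ} (hf : IntervalIntegrable f volume 0 1)
    (hu : IntervalIntegrable u volume 0 1) {x l r l' r' : ℝ} (hx : x ∈ Ioo (0 : ℝ) 1)
    (hl : HasLeftApproxLim u x l) (hr : HasRightApproxLim u x r)
    (hl' : HasLeftApproxLim f x l') (hr' : HasRightApproxLim f x r')
    (hmax : ∀ y ∈ Ioo (0 : ℝ) 1,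
      primitive u y - primitive f y ≤ primitive u x - primitive f x) : l' ≤ l ∧ r ≤ r' := by
  rw [hasLeftApproxLim_iff hu hx] at hl
  rw [hasRightApproxLim_iff hu hx] at hr
  rw [hasLeftApproxLim_iff hf hx] at hl'
  rw [hasRightApproxLim_iff hf hx] at hr'
  constructor
  · refine le_of_tendsto_of_tendsto hl' hl ?_
    filter_upwards [Ioo_mem_nhdsLT hx.1] with y hy
    have := hmax y ⟨hy.1, hy.2.trans hx.2⟩
    exact div_le_div_of_nonneg_right (by linarith) (sub_nonneg.2 hy.2.le)
  · refine le_of_tendsto_of_tendsto hr hr' ?_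
    filter_upwards [Ioo_mem_nhdsGT hx.2] with y hy
    have := hmax y ⟨hx.1.trans hy.1, hy.2⟩
    exact div_le_div_of_nonneg_right (by linarith) (sub_nonneg.2 hy.1.le)

theorem HasLeftApproxLim.neg {w : ℝ → ℝ} {x l : ℝ} (h : HasLeftApproxLim w x l) :
    HasLeftApproxLim (fun t => -w t) x (-l) :=
  (Tendsto.neg h).congr fun y => by
    simp only [interval_average_eq, intervalIntegral.integral_neg, smul_neg]

theorem HasRightApproxLim.neg {w : ℝ → ℝ} {x r : ℝ} (h : HasRightApproxLim w x r) :
    HasRightApproxLim (fun t => -w t) x (-r) :=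
  (Tendsto.neg h).congr fun y => by
    simp only [interval_average_eq, intervalIntegral.integral_neg, smul_neg]

theorem primitive_neg (g : ℝ → ℝ) : primitive (fun t => -g t) = fun x => -primitive g x :=
  funext fun _ => intervalIntegral.integral_neg

/-- A jump of the derivative of a taut function lies on a contact set. -/
theorem IsTaut.abs_sub_eq_of_jump {f u : ℝ → ℝ} {α x l r : ℝ}
    (h : IsTaut (primitive f) α (primitive u)) (hf : IntervalIntegrable f volume 0 1)
    (hu : IntervalIntegrable u volume 0 1) (hx : x ∈ Ioo (0 : ℝ) 1)
    (hl : HasLeftApproxLim u x l) (hr : HasRightApproxLim u x r) (hlr : l ≠ r) :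
    primitive u x = primitive f x + α ∨ primitive u x = primitive f x - α := by
  by_contra! hne
  have hF := continuousOn_primitive hf
  rw [hasLeftApproxLim_iff hu hx] at hl
  rw [hasRightApproxLim_iff hu hx] at hr
  have hb := abs_le.1 (h.mem_tube x (Ioo_subset_Icc_self hx))
  have h1 := h.right_slope_le_left hF hx (lt_of_le_of_ne (by linarith) hne.1) hl hr
  have h2 := h.left_slope_le_right hF hx (lt_of_le_of_ne (by linarith) hne.2.symm) hl hr
  exact hlr (le_antisymm h2 h1)

/-- A jump of the derivative of a taut function on the upper contact set is a jump of `f`. -/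
theorem IsTaut.approxLim_ne_of_upper {f u : ℝ → ℝ} {α x l r l' r' : ℝ} (hα : 0 < α)
    (h : IsTaut (primitive f) α (primitive u)) (hf : IntervalIntegrable f volume 0 1)
    (hu : IntervalIntegrable u volume 0 1) (hx : x ∈ Ioo (0 : ℝ) 1)
    (hl : HasLeftApproxLim u x l) (hr : HasRightApproxLim u x r) (hlr : l ≠ r)
    (hl' : HasLeftApproxLim f x l') (hr' : HasRightApproxLim f x r')
    (hc : primitive u x = primitive f x + α) : l' ≠ r' := by
  obtain ⟨h1, h2⟩ := approxLim_le_of_touch hf hu hx hl hr hl' hr' fun y hy => by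
    linarith [(abs_le.1 (h.mem_tube y (Ioo_subset_Icc_self hy))).2]
  -- As `α > 0`, an upper contact point is off the lower contact set, so the slopes of the string
  -- increase there.
  rw [hasLeftApproxLim_iff hu hx] at hl
  rw [hasRightApproxLim_iff hu hx] at hr
  have h3 := h.left_slope_le_right (continuousOn_primitive hf) hx (by linarith) hl hr
  exact (h1.trans_lt ((lt_of_le_of_ne h3 hlr).trans_le h2)).ne

theorem IsTaut.jumpSet_subset {f u : ℝ → ℝ} {α : ℝ} (hα : 0 < α)
    (h : IsTaut (primitive f) α (primitive u)) (hf : IntervalIntegrable f volume 0 1)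
    (hu : IntervalIntegrable u volume 0 1)
    (hlim : ∀ x ∈ Ioo (0 : ℝ) 1,
      (∃ l, HasLeftApproxLim f x l) ∧ (∃ r, HasRightApproxLim f x r)) :
    jumpSet u ⊆ jumpSet f := by
  rintro x ⟨hx, l, r, hl, hr, hlr⟩
  obtain ⟨⟨l', hl'⟩, r', hr'⟩ := hlim x hx
  refine ⟨hx, l', r', hl', hr', ?_⟩
  rcases h.abs_sub_eq_of_jump hf hu hx hl hr hlr with hc | hc
  · exact h.approxLim_ne_of_upper hα hf hu hx hl hr hlr hl' hr' hc
  · have hneg := h.neg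
    rw [← primitive_neg, ← primitive_neg] at hneg
    have := hneg.approxLim_ne_of_upper hα hf.neg hu.neg hx hl.neg hr.neg (neg_injective.ne hlr)
      hl'.neg hr'.neg (by rw [primitive_neg, primitive_neg]; linarith)
    exact fun heq => this (by rw [heq])

/-- The approximate limits depend only on the primitive near the point, up to a constant. -/
theorem mem_jumpSet_iff_of_eventually {f u : ℝ → ℝ} (hf : IntervalIntegrable f volume 0 1)
    (hu : IntervalIntegrable u volume 0 1) {x : ℝ}
    (h : ∀ᶠ y in 𝓝 x, primitive u y - primitive f y = primitive u x - primitive f x) :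
    x ∈ jumpSet u ↔ x ∈ jumpSet f := by
  refine and_congr_right fun hx => exists₂_congr fun l r => ?_
  rw [hasLeftApproxLim_iff hu hx, hasRightApproxLim_iff hu hx, hasLeftApproxLim_iff hf hx,
    hasRightApproxLim_iff hf hx]
  refine and_congr (tendsto_congr' ?_) (and_congr_left' (tendsto_congr' ?_))
  · filter_upwards [nhdsWithin_le_nhds h] with y hy
    rw [show primitive u x - primitive u y = primitive f x - primitive f y by linarith]
  · filter_upwards [nhdsWithin_le_nhds h] with y hy
    rw [show primitive u y - primitive u x = primitive f y - primitive f x by linarith]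

/-- Near an interior point of the contact set, the difference of the string and the primitive of
the datum is constant. -/
theorem eventually_sub_eq_of_mem_interior {f U : ℝ → ℝ} {α x : ℝ} (hα : 0 < α)
    (hf : IntervalIntegrable f volume 0 1) (hU : ContinuousOn U (Icc 0 1))
    (hx : x ∈ interior (upperContact f α U ∪ lowerContact f α U)) :
    ∀ᶠ y in 𝓝 x, U y - primitive f y = U x - primitive f x := by
  have hval : ∀ y ∈ upperContact f α U ∪ lowerContact f α U,
      U y - primitive f y = α ∨ U y - primitive f y = -α := by
    rintro y (hy | hy)
    · exact .inl (by linarith [hy.2])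
    · exact .inr (by linarith [hy.2])
  have hxC := interior_subset hx
  have hx01 : x ∈ Ioo (0 : ℝ) 1 := hxC.elim And.left And.left
  have hc : ContinuousAt (fun y => U y - primitive f y) x :=
    (hU.sub (continuousOn_primitive hf)).continuousAt (Icc_mem_nhds hx01.1 hx01.2)
  -- The two possible values `α` and `-α` are `2 * α` apart, so an oscillation below `α` excludes a
  -- switch.
  filter_upwards [mem_interior_iff_mem_nhds.1 hx, Metric.continuousAt_iff'.1 hc α hα] with y hy hd
  rw [Real.dist_eq, abs_lt] at hd
  rcases hval y hy with h1 | h1 <;> rcases hval x hxC with h2 | h2 <;>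
    rw [h1, h2] at hd ⊢ <;> linarith [hd.1, hd.2]

end TautString

theorem proposition3p3 (f : ℝ → ℝ) (hf : MemLp f ∞ TautString.lebUnit)
    (hlim : ∀ x ∈ Ioo (0 : ℝ) 1,
      (∃ l, TautString.HasLeftApproxLim f x l) ∧ (∃ r, TautString.HasRightApproxLim f x r))
    (α : ℝ) (hα : 0 < α) (u U : ℝ → ℝ)
    (hu : TautString.IsROFSolution f α u) (hU : TautString.IsTautStringSolution f α U) :
    TautString.jumpSet u ⊆ TautString.jumpSet f ∩
        (TautString.upperContact f α U ∪ TautString.lowerContact f α U) ∧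
      TautString.jumpSet u ∩
          interior (TautString.upperContact f α U ∪ TautString.lowerContact f α U) =
        TautString.jumpSet f ∩
          interior (TautString.upperContact f α U ∪ TautString.lowerContact f α U) ∧
      TautString.jumpSet u ∩
          frontier (TautString.upperContact f α U ∪ TautString.lowerContact f α U) ⊆
        TautString.jumpSet f := by
  have hf2 : MemLp f 2 TautString.lebUnit := hf.mono_exponent le_top
  have hfi := TautString.intervalIntegrable_of_memLp hf2
  have hui := TautString.integrable_lebUnit_iff.1 hu.1.1
  have htaut := hu.isTaut hα.le hf2
  -- Uniqueness of taut functions identifies the string with the primitive of the ROF solution.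
  have heq : EqOn U (TautString.primitive u) (Icc 0 1) := fun x hx =>
    (hU.1.eqOn_primitive_deriv hx).trans
      ((hU.isTaut hα.le).eqOn htaut (TautString.continuousOn_primitive hfi) hx)
  have hsub := htaut.jumpSet_subset hα hfi hui hlim
  refine ⟨fun x hx => ⟨hsub hx, ?_⟩, ?_, inter_subset_left.trans hsub⟩
  · obtain ⟨hx01, l, r, hl, hr, hlr⟩ := hx
    have hUx := heq (Ioo_subset_Icc_self hx01)
    rcases htaut.abs_sub_eq_of_jump hfi hui hx01 hl hr hlr with hc | hc
    · exact .inl ⟨hx01, hUx.trans hc⟩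
    · exact .inr ⟨hx01, hUx.trans hc⟩
  · ext x
    refine and_congr_left fun hx => TautString.mem_jumpSet_iff_of_eventually hfi hui ?_
    have hx01 : x ∈ Ioo (0 : ℝ) 1 := (interior_subset hx).elim And.left And.left
    have hUc : ContinuousOn U (Icc 0 1) := htaut.continuousOn.congr heq
    filter_upwards [TautString.eventually_sub_eq_of_mem_interior hα hfi hUc hx,
      Icc_mem_nhds hx01.1 hx01.2] with y hy hy01
    rwa [heq hy01, heq (Ioo_subset_Icc_self hx01)] at hy
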